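/- For $0<\varepsilon<1$ let $\eta_\varepsilon\in H^1(\mathbb R)$ with $x\eta_\varepsilon\in L^2(\mathbb R)$ be the positive solution of $$\varepsilon^2\eta_\varepsilon''(x)+(1-x^2-\eta_\varepsilon(x)^2)\,\eta_\varepsilon(x)=0,\qquad x\in\mathbb R.$$ For $\gamma>1$ and $\Phi=(\phi_1,\phi_2)\in H^1_{\rm loc}(\mathbb R;\mathbb R^2)$ define, with values in $[0,\infty]$, $$J_\varepsilon(\Phi)=\frac12\int_{\mathbb R}\Big[\eta_\varepsilon(\varepsilon z)^2\big((\phi_1')^2+(\phi_2')^2\big)+\tfrac12\eta_\varepsilon(\varepsilon z)^4(\phi_1^2+\phi_2^2-1)^2+(\gamma-1)\eta_\varepsilon(\varepsilon z)^4\phi_1^2\phi_2^2\Big]dz,$$ $$J_0(\Phi)=\frac12\int_{\mathbb R}\Big[(\phi_1')^2+(\phi_2')^2+\tfrac12(\phi_1^2+\phi_2^2-1)^2+(\gamma-1)\phi_1^2\phi_2^2\Big]dz,$$ and set $J_0(\Phi)=\infty$ for $\Phi\in L^2_{\rm loc}(\mathbb R;\mathbb R^2)\setminus H^1_{\rm loc}(\mathbb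 R;\mathbb R^2)$. **Theorem.** Let $\gamma>1$. Then $J_\varepsilon$ $\Gamma$-converges to $J_0$ as $\varepsilon\to0$, in the following sense. (i) (Compactness) Let $\varepsilon_n\in(0,1)$, $\varepsilon_n\to0$, and $\Phi_n\in H^1_{\rm loc}(\mathbb R;\mathbb R^2)$ with $\sup_n J_{\varepsilon_n}(\Phi_n)<\infty$. Then there are a subsequence $(\Phi_{n_k})$ and $\Phi\in H^1_{\rm loc}(\mathbb R;\mathbb R^2)$ such that $\Phi_{n_k}\rightharpoonup\Phi$ weakly in $H^1_{\rm loc}(\mathbb R;\mathbb R^2)$, that is, weakly in $H^1((-R,R);\mathbb R^2)$ for every $R>0$. (ii) ($\Gamma$-liminf inequality) Let $\varepsilon_n\in(0,1)$, $\varepsilon_n\to0$, $\Phi_n\in H^1_{\rm loc}(\mathbb R;\mathbb R^2)$ and $\Phi\in L^2_{\rm loc}(\mathbb R;\mathbb R^2)$. If $\Phi_n\to\Phi$ in $L^2_{\rm loc}(\mathbb R;\mathbb R^2)$, then $\liminf_{n\to\infty}J_{\varepsilon_n}(\Phi_n)\ge J_0(\Phi)$. (iii) ($\Gamma$-limsup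 inequality) For every $\Phi\in H^1_{\rm loc}(\mathbb R;\mathbb R^2)$ there is a family $\Phi_\varepsilon\in H^1_{\rm loc}(\mathbb R;\mathbb R^2)$, which can be taken constant, $\Phi_\varepsilon=\Phi$, such that $\Phi_\varepsilon\to\Phi$ in $L^2_{\rm loc}(\mathbb R;\mathbb R^2)$ as $\varepsilon\to0$ and $\limsup_{\varepsilon\to0}J_\varepsilon(\Phi_\varepsilon)\le J_0(\Phi)$. -/

import Mathlib

open MeasureTheory Filter Set
open scoped Topology ContDiff ENNReal

noncomputable section

namespace DomainWalls

/-- `η` is a positive solution in `H¹(ℝ) ∩ L^{2,1}(ℝ)` of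
`ε² η'' + (1 - x² - η²) η = 0` on `ℝ`. Since `η` is of class `C²`, its weak derivative is `deriv η`. -/
structure IsGroundState (ε : ℝ) (η : ℝ → ℝ) : Prop where
  contDiff : ContDiff ℝ 2 η
  pos : ∀ x, 0 < η x
  equation : ∀ x, ε ^ 2 * deriv (deriv η) x + (1 - x ^ 2 - η x ^ 2) * η x = 0
  memLp : MemLp η 2 volume
  memLp_deriv : MemLp (deriv η) 2 volume
  memLp_weight : MemLp (fun x => |x| * η x) 2 volume

/-- `g` is the weak (distributional) derivative of `f` on `ℝ`, both being locally integrable. -/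
structure IsWeakDeriv (f g : ℝ → ℝ) : Prop where
  left : LocallyIntegrable f volume
  right : LocallyIntegrable g volume
  integral_eq : ∀ χ : ℝ → ℝ, ContDiff ℝ ∞ χ → HasCompactSupport χ →
    ∫ x, f x * deriv χ x = -∫ x, g x * χ x

open Classical in
/-- The weak derivative of `f` (well defined up to null sets), and `0` if there is none. -/
def weakDeriv (f : ℝ → ℝ) : ℝ → ℝ :=
  if h : ∃ g, IsWeakDeriv f g then h.choose else 0

/-- Membership in `L²_loc(ℝ)`. -/
def MemL2loc (f : ℝ → ℝ) : Prop :=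
  ∀ K : Set ℝ, IsCompact K → MemLp f 2 (volume.restrict K)

/-- Membership in `H¹_loc(ℝ)`. -/
def MemH1loc (f : ℝ → ℝ) : Prop :=
  MemL2loc f ∧ ∃ g, MemL2loc g ∧ IsWeakDeriv f g

/-- Pairs `Φ = (φ₁, φ₂)` of real functions on `ℝ`; `φ₁ = Φ 0` and `φ₂ = Φ 1`. -/
abbrev Pair : Type := Fin 2 → ℝ → ℝ

/-- `Φ ∈ L²_loc(ℝ; ℝ²)`. -/
def PairL2loc (Φ : Pair) : Prop := ∀ i, MemL2loc (Φ i)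

/-- `Φ ∈ H¹_loc(ℝ; ℝ²)`. -/
def PairH1loc (Φ : Pair) : Prop := ∀ i, MemH1loc (Φ i)

/-- Convergence `Φₐ → Φ` in `L²_loc(ℝ; ℝ²)` along the filter `l`: convergence in `L²(K)` for every
compact `K`. -/
def TendstoL2loc {ι : Type} (Φs : ι → Pair) (l : Filter ι) (Φ : Pair) : Prop :=
  ∀ K : Set ℝ, IsCompact K → ∀ i,
    Tendsto (fun a => eLpNorm (Φs a i - Φ i) 2 (volume.restrict K)) l (𝓝 0)

/-- Weak convergence `Φₙ ⇀ Φ` in `H¹_loc(ℝ; ℝ²)`: on every bounded interval, the functions and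
their weak derivatives converge weakly in `L²`. -/
def WeakTendstoH1loc (Φs : ℕ → Pair) (Φ : Pair) : Prop :=
  ∀ R : ℝ, 0 < R → ∀ i, ∀ g : ℝ → ℝ, MemLp g 2 (volume.restrict (Icc (-R) R)) →
    Tendsto (fun n => ∫ z in Icc (-R) R, Φs n i z * g z) atTop
      (𝓝 (∫ z in Icc (-R) R, Φ i z * g z)) ∧
    Tendsto (fun n => ∫ z in Icc (-R) R, weakDeriv (Φs n i) z * g z) atTop
      (𝓝 (∫ z in Icc (-R) R, weakDeriv (Φ i) z * g z))

/-- The energy density with weight `w`,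
`½ [w² (φ₁')² + w² (φ₂')² + ½ w⁴ (φ₁² + φ₂² - 1)² + (γ - 1) w⁴ φ₁² φ₂²]`. -/
def density (γ : ℝ) (w : ℝ → ℝ) (Φ : Pair) (z : ℝ) : ℝ :=
  1 / 2 * (w z ^ 2 * weakDeriv (Φ 0) z ^ 2 + w z ^ 2 * weakDeriv (Φ 1) z ^ 2
    + 1 / 2 * w z ^ 4 * (Φ 0 z ^ 2 + Φ 1 z ^ 2 - 1) ^ 2
    + (γ - 1) * w z ^ 4 * Φ 0 z ^ 2 * Φ 1 z ^ 2)

open Classical in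
/-- The weighted energy, with values in `[0, ∞]` (its density is nonnegative for `γ ≥ 1`); it is `∞`
outside `H¹_loc(ℝ; ℝ²)`. -/
def energy (γ : ℝ) (w : ℝ → ℝ) (Φ : Pair) : ℝ≥0∞ :=
  if PairH1loc Φ then ∫⁻ z, ENNReal.ofReal (density γ w Φ z) else ⊤

/-- `J_ε`, the energy with weight `z ↦ η (ε z)`, where `η` is the ground state for `ε`. -/
def J (γ ε : ℝ) (η : ℝ → ℝ) (Φ : Pair) : ℝ≥0∞ := energy γ (fun z => η (ε * z)) Φ

/-- `J₀`, the homogeneous domain-wall energy (weight `1`). -/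
def J₀ (γ : ℝ) (Φ : Pair) : ℝ≥0∞ := energy γ (fun _ => 1) Φ

end DomainWalls

end

/-! Everything rests on two bounds for the weight $\eta_\varepsilon(\varepsilon z)$: it never
exceeds 1, and it tends to 1 locally uniformly in $z$. The upper bound (`le_one`) is the maximum
principle. The lower bound (`sqrt_mul_cos_le`) compares $\eta_\varepsilon$ with a cosine of width
$\sqrt\varepsilon$, which in the variable $z$ is the slowly varying
$\sqrt{1-4\varepsilon}\cos(\sqrt\varepsilon z)$.

The upper bound gives $J_\varepsilon(\Phi)\le J_0(\Phi)$ at once, so constant families recover the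
energy. The lower bound gives $\eta_\varepsilon(\varepsilon z)\ge 1/4$ for
$|z|\le\varepsilon^{-1/2}$ and small $\varepsilon$. Bounded energy therefore controls the unweighted
density on growing intervals, hence functions and derivatives in $L^2_{\rm loc}$, and weak
compactness follows.

For the liminf inequality, pass to a subsequence of bounded energy; its weak limit must be $\Phi$,
so $\Phi\in H^1_{\rm loc}$. On $[-R,R]$ the weight is at least some $\theta_n\to1$, and the
unweighted energy is lower semicontinuous: by convexity in the gradients, by Fatou in the potential
(`setLIntegral_density_one_le_of_tendsto`). Finally $R\to\infty$. -/

namespace DomainWalls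

/-! ### Upper and lower bounds for the ground state -/

/-- A negative second derivative would make the point a local maximum as well, so the function would
be locally constant. -/
theorem deriv_deriv_nonneg_of_isLocalMin {f : ℝ → ℝ} {x : ℝ} (hf : ContinuousAt f x)
    (h : IsLocalMin f x) : 0 ≤ deriv (deriv f) x := by
  by_contra! hneg
  have hmax := isLocalMax_of_deriv_deriv_neg hneg h.deriv_eq_zero hf
  have heq : f =ᶠ[𝓝 x] fun _ => f x := by
    filter_upwards [h, hmax] with y h1 h2 using le_antisymm h2 h1
  have h2 := heq.deriv.deriv_eq
  simp at h2
  exact hneg.ne h2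

namespace IsGroundState

variable {ε : ℝ} {η : ℝ → ℝ}

/-- Both $\eta^2$ and its derivative $2\eta\eta'$ are integrable, which forces $\eta^2$ to vanish at
infinity. -/
theorem tendsto_zero_cocompact (h : IsGroundState ε η) : Tendsto η (cocompact ℝ) (𝓝 0) := by
  have hd : ∀ x, HasDerivAt η (deriv η x) x := fun x =>
    (h.contDiff.differentiable (by norm_num) x).hasDerivAt
  have hderiv : ∀ x, HasDerivAt (fun x => η x * η x) (deriv η x * η x + η x * deriv η x) x :=
    fun x => (hd x).mul (hd x)
  have hint : Integrable (fun x => η x * η x) volume := h.memLp.integrable_mul h.memLp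
  have hint' : Integrable (fun x => deriv η x * η x + η x * deriv η x) volume :=
    (h.memLp_deriv.integrable_mul h.memLp).add (h.memLp.integrable_mul h.memLp_deriv)
  have h1 := tendsto_zero_of_hasDerivAt_of_integrableOn_Ioi (a := 0)
    (fun x _ => hderiv x) hint'.integrableOn hint.integrableOn
  have h2 := tendsto_zero_of_hasDerivAt_of_integrableOn_Iic (a := 0)
    (fun x _ => hderiv x) hint'.integrableOn hint.integrableOn
  have h3 : Tendsto (fun x => η x * η x) (cocompact ℝ) (𝓝 0) := by
    rw [cocompact_eq_atBot_atTop]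
    exact h2.sup h1
  have h4 := (Real.continuous_sqrt.tendsto 0).comp h3
  simp only [Real.sqrt_zero] at h4
  refine h4.congr fun x => ?_
  simp [Real.sqrt_mul_self (h.pos x).le]

/-- Decay at infinity yields a global maximum point $y$. There $\eta''\le0$, so the equation gives
$1-y^2-\eta(y)^2\ge0$. -/
theorem le_one (h : IsGroundState ε η) (x : ℝ) : η x ≤ 1 := by
  obtain ⟨y, hy⟩ := h.contDiff.continuous.exists_forall_ge_of_isBounded 0 (by
    have := h.tendsto_zero_cocompact.eventually (gt_mem_nhds (h.pos 0))
    obtain ⟨K, hK, hKs⟩ := mem_cocompact.1 this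
    refine hK.isBounded.subset fun z hz => ?_
    by_contra hzK
    exact (show η z < η 0 from hKs hzK).not_ge hz)
  refine (hy x).trans ?_
  have hmin : IsLocalMin (fun z => -η z) y := Eventually.of_forall fun z => neg_le_neg (hy z)
  have h2 := deriv_deriv_nonneg_of_isLocalMin h.contDiff.continuous.neg.continuousAt hmin
  have e : deriv (-η) = -deriv η := by
    ext z
    exact deriv.neg
  change 0 ≤ deriv (deriv (-η)) y at h2
  rw [e, deriv.neg] at h2
  have h3 := h.equation y
  have h4 : 0 ≤ (1 - y ^ 2 - η y ^ 2) * η y := by nlinarith [sq_nonneg ε]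
  have h5 := nonneg_of_mul_nonneg_left h4 (h.pos y)
  nlinarith [h.pos y, sq_nonneg y]

/-- A truncated cosine is a subsolution of the equation, and lies below the ground state. -/
theorem mul_cos_le (h : IsGroundState ε η) {κ s : ℝ} (hκ : 0 < κ) (hs : 0 ≤ s)
    (hlt : (ε * κ) ^ 2 + (Real.pi / (2 * κ)) ^ 2 + s ^ 2 < 1) {x : ℝ}
    (hx : x ∈ Icc (-(Real.pi / (2 * κ))) (Real.pi / (2 * κ))) :
    s * Real.cos (κ * x) ≤ η x := by
  set a := Real.pi / (2 * κ) with ha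
  have hη := h.contDiff.continuous
  have hκa : κ * a = Real.pi / 2 := by rw [ha]; field_simp
  have hq : ContinuousOn (fun y => s * Real.cos (κ * y) / η y) (Icc (-a) a) :=
    (Continuous.div (by fun_prop) hη fun y => (h.pos y).ne').continuousOn
  obtain ⟨y, hy, hmax⟩ := isCompact_Icc.exists_isMaxOn ⟨x, hx⟩ hq
  by_contra! hcon
  set M := s * Real.cos (κ * y) / η y with hM
  have hM1 : 1 < M := ((one_lt_div (h.pos x)).2 hcon).trans_le (hmax hx)
  have hMy : M * η y = s * Real.cos (κ * y) := by
    rw [hM, div_mul_cancel₀ _ (h.pos y).ne']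
  have hpos : 0 < s * Real.cos (κ * y) := by
    rw [← hMy]; exact mul_pos (by linarith) (h.pos y)
  -- The cosine vanishes at both endpoints, so the ratio is maximal in the interior.
  have hya : y ∈ Ioo (-a) a := by
    refine ⟨lt_of_le_of_ne hy.1 ?_, lt_of_le_of_ne hy.2 ?_⟩
    · rintro rfl
      rw [mul_neg, hκa, Real.cos_neg, Real.cos_pi_div_two, mul_zero] at hpos
      exact lt_irrefl _ hpos
    · rintro rfl
      rw [hκa, Real.cos_pi_div_two, mul_zero] at hpos
      exact lt_irrefl _ hpos
  -- $M\eta$ touches the cosine from above at $y$, so second derivatives can be compared there.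
  have hmin : IsLocalMin (fun z => M * η z - s * Real.cos (κ * z)) y := by
    filter_upwards [Ioo_mem_nhds hya.1 hya.2] with z hz
    have h1 : s * Real.cos (κ * z) / η z ≤ M := hmax (Ioo_subset_Icc_self hz)
    rw [div_le_iff₀ (h.pos z)] at h1
    linarith
  have h2 := deriv_deriv_nonneg_of_isLocalMin (by fun_prop) hmin
  have hd : ∀ x, HasDerivAt η (deriv η x) x := fun x =>
    (h.contDiff.differentiable (by norm_num) x).hasDerivAt
  have hdd : ∀ x, HasDerivAt (deriv η) (deriv (deriv η) x) x := fun x =>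
    ((h.contDiff.differentiable_deriv_two) x).hasDerivAt
  have hlin : ∀ z, HasDerivAt (fun z => κ * z) κ z := fun z => by
    simpa using (hasDerivAt_id z).const_mul κ
  have e1 : deriv (fun z => M * η z - s * Real.cos (κ * z)) =
      fun z => M * deriv η z - s * (-Real.sin (κ * z) * κ) := by
    ext z
    exact (((hd z).const_mul M).sub (((hlin z).cos).const_mul s)).deriv
  have e2 : deriv (fun z => M * deriv η z - s * (-Real.sin (κ * z) * κ)) y =
      M * deriv (deriv η) y - s * (-(Real.cos (κ * y) * κ) * κ) :=
    (((hdd y).const_mul M).sub ((((hlin y).sin.neg).mul_const κ).const_mul s)).deriv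
  rw [e1, e2] at h2
  have h3 := h.equation y
  have h4 : 0 ≤ ((ε * κ) ^ 2 - (1 - y ^ 2 - η y ^ 2)) * (M * η y) := by
    have : ((ε * κ) ^ 2 - (1 - y ^ 2 - η y ^ 2)) * (M * η y) =
        ε ^ 2 * (M * deriv (deriv η) y - s * (-(Real.cos (κ * y) * κ) * κ)) := by
      linear_combination (ε * κ) ^ 2 * hMy - M * h3
    rw [this]; positivity
  -- Hence $1-y^2-\eta(y)^2\le(\varepsilon\kappa)^2$; since $M>1$ gives $\eta(y)\le s$, this
  -- contradicts `hlt`.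
  have h5 := nonneg_of_mul_nonneg_left h4 (by rw [hMy]; exact hpos)
  have h6 : η y ≤ s := by
    have : η y ≤ M * η y := le_mul_of_one_le_left (h.pos y).le hM1.le
    have : s * Real.cos (κ * y) ≤ s := mul_le_of_le_one_right hs (Real.cos_le_one _)
    linarith
  have h7 : y ^ 2 ≤ a ^ 2 := sq_le_sq' hy.1 hy.2
  have h8 : η y ^ 2 ≤ s ^ 2 := pow_le_pow_left₀ (h.pos y).le h6 2
  linarith

/-- The choice $\kappa=\varepsilon^{-1/2}$ balances the two errors:
$(\varepsilon\kappa)^2=\varepsilon$ and $(\pi/2\kappa)^2=\varepsilon\pi^2/4<3\varepsilon$. This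
leaves room for $s^2=1-4\varepsilon$. -/
theorem sqrt_mul_cos_le (h : IsGroundState ε η) (hε : 0 < ε) (hε' : ε < 1 / 4) {z : ℝ}
    (hz : |√ε * z| ≤ Real.pi / 2) : √(1 - 4 * ε) * Real.cos (√ε * z) ≤ η (ε * z) := by
  have hr : 0 < √ε := Real.sqrt_pos.2 hε
  have hrr : √ε * √ε = ε := Real.mul_self_sqrt hε.le
  have e1 : (√ε)⁻¹ * (ε * z) = √ε * z := by
    rw [← mul_assoc]; congr 1; field_simp; nlinarith
  rw [← e1]
  have ha : Real.pi / (2 * (√ε)⁻¹) = √ε * (Real.pi / 2) := by field_simp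
  refine h.mul_cos_le (inv_pos.2 hr) (Real.sqrt_nonneg _) ?_ ?_
  · have e2 : ε * (√ε)⁻¹ = √ε := by field_simp; nlinarith
    rw [ha, e2, mul_pow, Real.sq_sqrt hε.le, Real.sq_sqrt (by linarith)]
    have : (Real.pi / 2) ^ 2 < 3 := by nlinarith [Real.pi_lt_d2, Real.pi_pos]
    nlinarith
  · have e3 : ε * z = √ε * (√ε * z) := by rw [← mul_assoc, hrr]
    rw [ha, mem_Icc, ← abs_le, e3, abs_mul, abs_of_pos hr]
    exact mul_le_mul_of_nonneg_left hz hr.le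

theorem quarter_le (h : IsGroundState ε η) (hε : 0 < ε) (hε' : ε ≤ 1 / 8) {z : ℝ}
    (hz : |√ε * z| ≤ 1) : 1 / 4 ≤ η (ε * z) := by
  refine le_trans ?_ (h.sqrt_mul_cos_le hε (by linarith) (hz.trans ?_))
  · have h1 : 1 / 2 ≤ √(1 - 4 * ε) := Real.le_sqrt_of_sq_le (by norm_num; linarith)
    have h2 : 1 / 2 ≤ Real.cos (√ε * z) := by
      have := Real.one_sub_sq_div_two_le_cos (x := √ε * z)
      have := (sq_le_one_iff_abs_le_one _).2 hz
      linarith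
    nlinarith
  · linarith [Real.pi_gt_three]

end IsGroundState

/-! ### Weak sequential compactness in $L^2$ -/

theorem memLp_two_of_lintegral_sq_le {α : Type*} [MeasurableSpace α] {μ : Measure α} {f : α → ℝ}
    (hf : AEStronglyMeasurable f μ) {C : ℝ≥0∞} (hC : C < ⊤)
    (h : ∫⁻ x, ENNReal.ofReal (f x ^ 2) ∂μ ≤ C) :
    MemLp f 2 μ ∧ eLpNorm f 2 μ ≤ C ^ (1 / 2 : ℝ) := by
  have e : eLpNorm f 2 μ = (∫⁻ x, ENNReal.ofReal (f x ^ 2) ∂μ) ^ (1 / 2 : ℝ) := by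
    rw [eLpNorm_eq_lintegral_rpow_enorm_toReal (by norm_num) (by norm_num)]
    simp only [ENNReal.toReal_ofNat, ENNReal.rpow_ofNat]
    congr 1
    refine lintegral_congr fun x => ?_
    rw [← sq_abs, ENNReal.ofReal_pow (abs_nonneg _), Real.enorm_eq_ofReal_abs]
  have hle : eLpNorm f 2 μ ≤ C ^ (1 / 2 : ℝ) := by
    rw [e]; exact ENNReal.rpow_le_rpow h (by norm_num)
  exact ⟨⟨hf, hle.trans_lt (ENNReal.rpow_lt_top_of_nonneg (by norm_num) hC.ne)⟩, hle⟩

theorem integral_mul_eq_inner {α : Type*} [MeasurableSpace α] {μ : Measure α} {f g : α → ℝ}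
    (hf : MemLp f 2 μ) (hg : MemLp g 2 μ) :
    ∫ x, f x * g x ∂μ = inner ℝ (hf.toLp f) (hg.toLp g) := by
  rw [L2.inner_def]
  refine integral_congr_ae ?_
  filter_upwards [hf.coeFn_toLp, hg.coeFn_toLp] with x h1 h2
  rw [h1, h2]
  simp [mul_comm]

/-- Bounded sequences in `L²(ℝ)` have weakly convergent subsequences. -/
theorem exists_subseq_tendsto_integral_mul {f : ℕ → ℝ → ℝ}
    (hf : ∀ n, AEStronglyMeasurable (f n) volume) {C : ℝ≥0∞} (hC : C < ⊤)
    (h : ∀ n, ∫⁻ x, ENNReal.ofReal (f n x ^ 2) ≤ C) :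
    ∃ (k : ℕ → ℕ) (u : ℝ → ℝ), StrictMono k ∧ MemLp u 2 volume ∧
      ∀ g : ℝ → ℝ, MemLp g 2 volume →
        Tendsto (fun n => ∫ x, f (k n) x * g x) atTop (𝓝 (∫ x, u x * g x)) := by
  have hL : ∀ n, MemLp (f n) 2 volume := fun n => (memLp_two_of_lintegral_sq_le (hf n) hC (h n)).1
  have hCt : C ^ (1 / 2 : ℝ) ≠ ⊤ := (ENNReal.rpow_lt_top_of_nonneg (by norm_num) hC.ne).ne
  let F : ℕ → Lp ℝ 2 (volume : Measure ℝ) := fun n => (hL n).toLp (f n)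
  have hF : ∀ n, ‖F n‖ ≤ (C ^ (1 / 2 : ℝ)).toReal := fun n => by
    rw [Lp.norm_toLp]
    exact ENNReal.toReal_mono hCt (memLp_two_of_lintegral_sq_le (hf n) hC (h n)).2
  -- A finite exponent makes $L^2$ separable, as sequential Banach–Alaoglu requires; the Riesz
  -- isometry `D` carries the sequence to the dual and the limit back.
  have : Fact ((2 : ℝ≥0∞) ≠ ⊤) := ⟨by norm_num⟩
  let D : Lp ℝ 2 (volume : Measure ℝ) ≃ₗᵢ[ℝ] StrongDual ℝ (Lp ℝ 2 (volume : Measure ℝ)) :=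
    (InnerProductSpace.toDual ℝ (Lp ℝ 2 (volume : Measure ℝ)))
  obtain ⟨T, -, k, hk, hT⟩ := WeakDual.isSeqCompact_closedBall ℝ (Lp ℝ 2 (volume : Measure ℝ)) 0
    (C ^ (1 / 2 : ℝ)).toReal (x := fun n => StrongDual.toWeakDual (D (F n))) (fun n => by
      simp only [mem_preimage, mem_closedBall_zero_iff]
      exact (D.norm_map (F n)).le.trans (hF n))
  obtain ⟨U, hU⟩ := D.surjective (WeakDual.toStrongDual T)
  refine ⟨k, U, hk, Lp.memLp U, fun g hg => ?_⟩
  have h1 := (tendsto_iff_forall_eval_tendsto_topDualPairing.1 hT) (hg.toLp g)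
  have h2 : ∫ x, U x * g x = (topDualPairing ℝ (Lp ℝ 2 (volume : Measure ℝ))) T (hg.toLp g) := by
    rw [integral_mul_eq_inner (Lp.memLp U) hg, Lp.toLp_coeFn]
    change _ = (WeakDual.toStrongDual T) (hg.toLp g)
    rw [← hU]; rfl
  rw [h2]
  refine h1.congr fun n => ?_
  rw [integral_mul_eq_inner (hL _) hg]
  rfl

/-! ### Local spaces, weak derivatives and local weak limits -/

theorem MemL2loc.locallyIntegrable {f : ℝ → ℝ} (hf : MemL2loc f) :
    LocallyIntegrable f volume := by
  refine locallyIntegrable_iff.2 fun K hK => ?_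
  have : IsFiniteMeasure (volume.restrict K) := ⟨by simpa using hK.measure_lt_top⟩
  exact (hf K hK).integrable (by norm_num)

theorem MemL2loc.aestronglyMeasurable {f : ℝ → ℝ} (hf : MemL2loc f) :
    AEStronglyMeasurable f volume :=
  hf.locallyIntegrable.aestronglyMeasurable

theorem MemL2loc.congr_ae {f g : ℝ → ℝ} (hf : MemL2loc f) (h : f =ᵐ[volume] g) : MemL2loc g :=
  fun K hK => (hf K hK).ae_eq (ae_restrict_of_ae h)

theorem IsWeakDeriv.congr_ae {f f' g : ℝ → ℝ} (h : IsWeakDeriv f g) (hf : f =ᵐ[volume] f') :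
    IsWeakDeriv f' g where
  left := h.left.congr hf
  right := h.right
  integral_eq χ hχ hχs := by
    rw [← h.integral_eq χ hχ hχs]
    refine integral_congr_ae ?_
    filter_upwards [hf] with x hx
    rw [hx]

theorem IsWeakDeriv.unique {f g g' : ℝ → ℝ} (h : IsWeakDeriv f g) (h' : IsWeakDeriv f g') :
    g =ᵐ[volume] g' := by
  refine ae_eq_of_integral_contDiff_smul_eq h.right h'.right fun χ hχ hχs => ?_
  have := (h.integral_eq χ hχ hχs).symm.trans (h'.integral_eq χ hχ hχs)
  simpa [mul_comm] using this

theorem IsWeakDeriv.isWeakDeriv_weakDeriv {f g : ℝ → ℝ} (h : IsWeakDeriv f g) :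
    IsWeakDeriv f (weakDeriv f) := by
  have hex : ∃ g, IsWeakDeriv f g := ⟨g, h⟩
  rw [weakDeriv, dif_pos hex]
  exact hex.choose_spec

theorem IsWeakDeriv.weakDeriv_ae_eq {f g : ℝ → ℝ} (h : IsWeakDeriv f g) :
    weakDeriv f =ᵐ[volume] g :=
  h.isWeakDeriv_weakDeriv.unique h

theorem MemH1loc.isWeakDeriv {f : ℝ → ℝ} (hf : MemH1loc f) : IsWeakDeriv f (weakDeriv f) := by
  obtain ⟨-, g, -, h⟩ := hf
  exact h.isWeakDeriv_weakDeriv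

theorem MemH1loc.memL2loc_weakDeriv {f : ℝ → ℝ} (hf : MemH1loc f) : MemL2loc (weakDeriv f) := by
  obtain ⟨-, g, hg, h⟩ := hf
  exact hg.congr_ae h.weakDeriv_ae_eq.symm

theorem MemH1loc.congr_ae {f g : ℝ → ℝ} (hf : MemH1loc f) (h : f =ᵐ[volume] g) : MemH1loc g :=
  ⟨hf.1.congr_ae h, weakDeriv f, hf.memL2loc_weakDeriv, hf.isWeakDeriv.congr_ae h⟩

theorem MemH1loc.weakDeriv_congr_ae {f g : ℝ → ℝ} (hf : MemH1loc f) (h : f =ᵐ[volume] g) :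
    weakDeriv f =ᵐ[volume] weakDeriv g :=
  ((hf.isWeakDeriv.congr_ae h).weakDeriv_ae_eq).symm

/-- Weak convergence in `L²((-R, R))` for every `R > 0`. -/
def WeakTendstoL2loc (φ : ℕ → ℝ → ℝ) (u : ℝ → ℝ) : Prop :=
  ∀ R : ℝ, 0 < R → ∀ g : ℝ → ℝ, MemLp g 2 (volume.restrict (Icc (-R) R)) →
    Tendsto (fun n => ∫ z in Icc (-R) R, φ n z * g z) atTop (𝓝 (∫ z in Icc (-R) R, u z * g z))

theorem WeakTendstoL2loc.comp {φ : ℕ → ℝ → ℝ} {u : ℝ → ℝ} (h : WeakTendstoL2loc φ u)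
    {k : ℕ → ℕ} (hk : StrictMono k) : WeakTendstoL2loc (fun n => φ (k n)) u :=
  fun R hR g hg => (h R hR g hg).comp hk.tendsto_atTop

theorem WeakTendstoL2loc.congr_ae_right {φ : ℕ → ℝ → ℝ} {u v : ℝ → ℝ}
    (h : WeakTendstoL2loc φ u) (huv : u =ᵐ[volume] v) : WeakTendstoL2loc φ v := by
  intro R hR g hg
  have e : ∫ z in Icc (-R) R, v z * g z = ∫ z in Icc (-R) R, u z * g z := by
    refine integral_congr_ae (ae_restrict_of_ae ?_)
    filter_upwards [huv] with x hx
    rw [hx]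
  rw [e]
  exact h R hR g hg

/-- Multiplying by $\rho$ and cutting off to `A n` gives a bounded sequence in $L^2(\mathbb R)$, so
one extraction serves every $R$ and no diagonal argument is needed. Since $\rho^{-1}$ is bounded on
compact sets, the weight is moved onto the test function. -/
theorem exists_subseq_weakTendstoL2loc {φ : ℕ → ℝ → ℝ} (hφ : ∀ n, MemL2loc (φ n))
    {ρ : ℝ → ℝ} (hρ : Continuous ρ) (hρ0 : ∀ x, ρ x ≠ 0) {A : ℕ → Set ℝ}
    (hA : ∀ n, MeasurableSet (A n)) (hAR : ∀ R : ℝ, ∀ᶠ n in atTop, Icc (-R) R ⊆ A n)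
    {C : ℝ≥0∞} (hC : C < ⊤) (h : ∀ n, ∫⁻ z in A n, ENNReal.ofReal ((ρ z * φ n z) ^ 2) ≤ C) :
    ∃ (k : ℕ → ℕ) (u : ℝ → ℝ), StrictMono k ∧ MemL2loc u ∧
      WeakTendstoL2loc (fun n => φ (k n)) u := by
  have hρi : Continuous fun z => (ρ z)⁻¹ := hρ.inv₀ hρ0
  obtain ⟨k, v, hk, hv, hlim⟩ := exists_subseq_tendsto_integral_mul
    (f := fun n => (A n).indicator fun z => ρ z * φ n z)
    (fun n => (hρ.aestronglyMeasurable.mul (hφ n).aestronglyMeasurable).indicator (hA n)) hC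
    (fun n => by
      refine le_trans (le_of_eq ?_) (h n)
      rw [← lintegral_indicator (hA n)]
      refine lintegral_congr fun z => ?_
      by_cases hz : z ∈ A n <;> simp [hz])
  have hbdd : ∀ K : Set ℝ, IsCompact K → ∀ g : ℝ → ℝ, MemLp g 2 (volume.restrict K) →
      MemLp (fun z => (ρ z)⁻¹ * g z) 2 (volume.restrict K) := by
    intro K hK g hg
    obtain ⟨M, hM⟩ := hK.exists_bound_of_continuousOn hρi.continuousOn
    refine hg.of_le_mul (c := M) (hρi.aestronglyMeasurable.mul hg.aestronglyMeasurable) ?_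
    filter_upwards [ae_restrict_mem hK.measurableSet] with z hz
    rw [norm_mul]
    exact mul_le_mul_of_nonneg_right (hM z hz) (norm_nonneg _)
  refine ⟨k, fun z => (ρ z)⁻¹ * v z, hk, fun K hK => hbdd K hK v (hv.restrict K), ?_⟩
  intro R hR g hg
  have hI : MeasurableSet (Icc (-R) R) := measurableSet_Icc
  have hlim' := hlim ((Icc (-R) R).indicator fun z => (ρ z)⁻¹ * g z)
    ((memLp_indicator_iff_restrict hI).2 (hbdd _ isCompact_Icc g hg))
  have e : ∫ z in Icc (-R) R, (ρ z)⁻¹ * v z * g z =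
      ∫ x, v x * (Icc (-R) R).indicator (fun z => (ρ z)⁻¹ * g z) x := by
    rw [← integral_indicator hI]
    refine integral_congr_ae (.of_forall fun z => ?_)
    by_cases hz : z ∈ Icc (-R) R
    · simp only [indicator_of_mem hz]; ring
    · simp only [indicator_of_notMem hz, mul_zero]
  rw [e]
  refine hlim'.congr' ?_
  filter_upwards [hk.tendsto_atTop.eventually (hAR R)] with n hn
  rw [← integral_indicator hI]
  refine integral_congr_ae (.of_forall fun z => ?_)
  by_cases hz : z ∈ Icc (-R) R
  · simp only [indicator_of_mem hz, indicator_of_mem (hn hz)]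
    have := hρ0 z
    field_simp
  · simp only [indicator_of_notMem hz, mul_zero]

/-- Weak derivatives pass to weak limits. -/
theorem IsWeakDeriv.of_weakTendsto {φ ψ : ℕ → ℝ → ℝ} {u p : ℝ → ℝ}
    (h : ∀ n, IsWeakDeriv (φ n) (ψ n)) (hu : MemL2loc u) (hp : MemL2loc p)
    (hφ : WeakTendstoL2loc φ u) (hψ : WeakTendstoL2loc ψ p) : IsWeakDeriv u p where
  left := hu.locallyIntegrable
  right := hp.locallyIntegrable
  integral_eq χ hχ hχs := by
    obtain ⟨R, hR, hsub⟩ : ∃ R : ℝ, 0 < R ∧ tsupport χ ⊆ Icc (-R) R := by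
      obtain ⟨R, hR⟩ := hχs.isCompact.isBounded.subset_closedBall 0
      refine ⟨max R 1, by positivity, hR.trans ?_⟩
      rw [Real.closedBall_eq_Icc]
      exact Icc_subset_Icc (by simp) (by simp)
    have hχ0 : ∀ z, z ∉ Icc (-R) R → χ z = 0 := fun z hz =>
      image_eq_zero_of_notMem_tsupport fun hz' => hz (hsub hz')
    have hχ'0 : ∀ z, z ∉ Icc (-R) R → deriv χ z = 0 := fun z hz =>
      image_eq_zero_of_notMem_tsupport fun hz' => hz (hsub (tsupport_deriv_subset hz'))
    have e1 : ∀ f : ℝ → ℝ, ∫ z in Icc (-R) R, f z * χ z = ∫ z, f z * χ z := fun f =>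
      setIntegral_eq_integral_of_forall_compl_eq_zero fun z hz => by rw [hχ0 z hz, mul_zero]
    have e2 : ∀ f : ℝ → ℝ, ∫ z in Icc (-R) R, f z * deriv χ z = ∫ z, f z * deriv χ z := fun f =>
      setIntegral_eq_integral_of_forall_compl_eq_zero fun z hz => by rw [hχ'0 z hz, mul_zero]
    have h1 := hψ R hR χ ((hχ.continuous.memLp_of_hasCompactSupport hχs).restrict _)
    have h2 := hφ R hR (deriv χ)
      (((hχ.continuous_deriv (by simp)).memLp_of_hasCompactSupport hχs.deriv).restrict _)
    simp only [e1] at h1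
    simp only [e2] at h2
    refine tendsto_nhds_unique h2 (h1.neg.congr fun n => ?_)
    exact ((h n).integral_eq χ hχ hχs).symm

theorem exists_subseq_weakTendsto_weakDeriv {φ : ℕ → ℝ → ℝ} (hφ : ∀ n, MemH1loc (φ n))
    {ρ : ℝ → ℝ} (hρ : Continuous ρ) (hρ0 : ∀ x, ρ x ≠ 0) {A : ℕ → Set ℝ}
    (hA : ∀ n, MeasurableSet (A n)) (hAR : ∀ R : ℝ, ∀ᶠ n in atTop, Icc (-R) R ⊆ A n)
    {C : ℝ≥0∞} (hC : C < ⊤) (h : ∀ n, ∫⁻ z in A n, ENNReal.ofReal ((ρ z * φ n z) ^ 2) ≤ C)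
    (h' : ∀ n, ∫⁻ z in A n, ENNReal.ofReal (weakDeriv (φ n) z ^ 2) ≤ C) :
    ∃ (k : ℕ → ℕ) (u : ℝ → ℝ), StrictMono k ∧ MemH1loc u ∧
      WeakTendstoL2loc (fun n => φ (k n)) u ∧
      WeakTendstoL2loc (fun n => weakDeriv (φ (k n))) (weakDeriv u) := by
  obtain ⟨k, u, hk, hu, hlim⟩ :=
    exists_subseq_weakTendstoL2loc (fun n => (hφ n).1) hρ hρ0 hA hAR hC h
  obtain ⟨l, p, hl, hp, hlim'⟩ :=
    -- The derivatives have a genuine $L^2$ bound, so the weight is 1.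
    exists_subseq_weakTendstoL2loc (φ := fun n => weakDeriv (φ (k n)))
      (fun n => (hφ _).memL2loc_weakDeriv) (ρ := fun _ => 1) continuous_const (by simp)
      (fun n => hA (k n)) (fun R => hk.tendsto_atTop.eventually (hAR R)) hC
      (fun n => by simpa using h' (k n))
  have hup : IsWeakDeriv u p :=
    IsWeakDeriv.of_weakTendsto (fun n => (hφ (k (l n))).isWeakDeriv) hu hp (hlim.comp hl) hlim'
  exact ⟨k ∘ l, u, hk.comp hl, ⟨hu, p, hp, hup⟩, hlim.comp hl,
    hlim'.congr_ae_right hup.weakDeriv_ae_eq.symm⟩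

theorem weakTendstoH1loc_of_forall {Φs : ℕ → Pair} {Φ : Pair}
    (h : ∀ i, WeakTendstoL2loc (fun n => Φs n i) (Φ i) ∧
      WeakTendstoL2loc (fun n => weakDeriv (Φs n i)) (weakDeriv (Φ i))) :
    WeakTendstoH1loc Φs Φ :=
  fun R hR i g hg => ⟨(h i).1 R hR g hg, (h i).2 R hR g hg⟩

/-! ### Pointwise comparison of energy densities -/

section Density

variable {γ : ℝ} {w : ℝ → ℝ} {Φ : Pair} {z : ℝ}

theorem density_one_nonneg (hγ : 1 ≤ γ) : 0 ≤ density γ (fun _ => 1) Φ z := by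
  have := sub_nonneg.2 hγ
  unfold density
  positivity

theorem density_le_density_one (hγ : 1 ≤ γ) (hw : 0 ≤ w z) (hw1 : w z ≤ 1) :
    density γ w Φ z ≤ density γ (fun _ => 1) Φ z := by
  have := sub_nonneg.2 hγ
  have h2 : w z ^ 2 ≤ 1 := pow_le_one₀ hw hw1
  have h4 : w z ^ 4 ≤ 1 := pow_le_one₀ hw hw1
  unfold density
  simp only [one_pow, mul_one]
  gcongr <;> nlinarith

/-- The weights are $w^2$ and $w^4$; as $\theta\le1$, the power $\theta^4$ lies below both. -/
theorem pow_four_mul_density_one_le (hγ : 1 ≤ γ) {θ : ℝ} (hθ : 0 ≤ θ) (hθ1 : θ ≤ 1)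
    (hw : θ ≤ w z) : θ ^ 4 * density γ (fun _ => 1) Φ z ≤ density γ w Φ z := by
  have := sub_nonneg.2 hγ
  have h4 : θ ^ 4 ≤ w z ^ 4 := pow_le_pow_left₀ hθ hw 4
  have h2 : θ ^ 4 ≤ w z ^ 2 :=
    (pow_le_pow_of_le_one hθ hθ1 (by norm_num)).trans (pow_le_pow_left₀ hθ hw 2)
  unfold density
  simp only [one_pow, mul_one, one_mul]
  have a1 := mul_le_mul_of_nonneg_right h2 (sq_nonneg (weakDeriv (Φ 0) z))
  have a2 := mul_le_mul_of_nonneg_right h2 (sq_nonneg (weakDeriv (Φ 1) z))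
  have a3 := mul_le_mul_of_nonneg_right h4 (sq_nonneg (Φ 0 z ^ 2 + Φ 1 z ^ 2 - 1))
  have a4 := mul_le_mul_of_nonneg_right h4
    (show 0 ≤ (γ - 1) * (Φ 0 z ^ 2 * Φ 1 z ^ 2) by positivity)
  linarith

theorem weakDeriv_sq_le_density_one (hγ : 1 ≤ γ) (i : Fin 2) :
    weakDeriv (Φ i) z ^ 2 ≤ 2 * density γ (fun _ => 1) Φ z := by
  have := sub_nonneg.2 hγ
  have a4 : 0 ≤ (γ - 1) * (Φ 0 z ^ 2 * Φ 1 z ^ 2) := by positivity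
  unfold density
  fin_cases i <;> simp only [Fin.zero_eta, Fin.mk_one, Fin.isValue] <;>
    nlinarith [sq_nonneg (weakDeriv (Φ 0) z), sq_nonneg (weakDeriv (Φ 1) z),
      sq_nonneg (Φ 0 z ^ 2 + Φ 1 z ^ 2 - 1)]

/-- With $t=\phi_1^2+\phi_2^2$, four times the density dominates $(t-1)^2$, and $t\le2+(t-1)^2$. -/
theorem sq_le_density_one (hγ : 1 ≤ γ) (i : Fin 2) :
    Φ i z ^ 2 ≤ 2 + 4 * density γ (fun _ => 1) Φ z := by
  have := sub_nonneg.2 hγ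
  have a4 : 0 ≤ (γ - 1) * (Φ 0 z ^ 2 * Φ 1 z ^ 2) := by positivity
  unfold density
  fin_cases i <;> simp only [Fin.zero_eta, Fin.mk_one, Fin.isValue] <;>
    nlinarith [sq_nonneg (weakDeriv (Φ 0) z), sq_nonneg (weakDeriv (Φ 1) z),
      sq_nonneg (Φ 0 z), sq_nonneg (Φ 1 z),
      sq_nonneg (Φ 0 z ^ 2 + Φ 1 z ^ 2 - 2)]

theorem ofReal_pow_four_mul_setLIntegral_le (hγ : 1 ≤ γ) {θ : ℝ} (hθ : 0 ≤ θ) (hθ1 : θ ≤ 1)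
    {A : Set ℝ} (hA : MeasurableSet A) (hw : ∀ z ∈ A, θ ≤ w z) (hΦ : PairH1loc Φ) :
    ENNReal.ofReal (θ ^ 4) * ∫⁻ z in A, ENNReal.ofReal (density γ (fun _ => 1) Φ z) ≤
      energy γ w Φ := by
  rw [energy, if_pos hΦ, ← lintegral_const_mul' _ _ ENNReal.ofReal_ne_top]
  refine (setLIntegral_mono' hA fun z hz => ?_).trans (setLIntegral_le_lintegral A _)
  rw [← ENNReal.ofReal_mul (by positivity)]
  exact ENNReal.ofReal_le_ofReal (pow_four_mul_density_one_le hγ hθ hθ1 (hw z hz))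

end Density

/-! ### Compactness -/

/-- The region on which the weight `z ↦ η (ε z)` is bounded below uniformly in `ε`. -/
def core (ε : ℝ) : Set ℝ := {z | |√ε * z| ≤ 1}

theorem measurableSet_core (ε : ℝ) : MeasurableSet (core ε) :=
  (isClosed_le (by fun_prop) continuous_const).measurableSet

theorem eventually_Icc_subset_core {ε : ℕ → ℝ} (hε : Tendsto ε atTop (𝓝 0)) (R : ℝ) :
    ∀ᶠ n in atTop, Icc (-R) R ⊆ core (ε n) := by
  have h : Tendsto (fun n => √(ε n) * |R|) atTop (𝓝 0) := by
    simpa using ((Real.continuous_sqrt.tendsto 0).comp hε).mul_const |R|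
  filter_upwards [h.eventually (gt_mem_nhds one_pos)] with n hn z hz
  change |√(ε n) * z| ≤ 1
  rw [abs_mul, abs_of_nonneg (Real.sqrt_nonneg _)]
  have hzR : |z| ≤ |R| := (abs_le.2 hz).trans (le_abs_self R)
  exact (mul_le_mul_of_nonneg_left hzR (Real.sqrt_nonneg _)).trans hn.le

theorem exists_subseq_weakTendstoH1loc_of_le {Φs : ℕ → Pair} (hΦ : ∀ n, PairH1loc (Φs n)) {γ : ℝ}
    (hγ : 1 ≤ γ) {A : ℕ → Set ℝ}
    (hA : ∀ n, MeasurableSet (A n)) (hAR : ∀ R : ℝ, ∀ᶠ n in atTop, Icc (-R) R ⊆ A n)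
    {C : ℝ≥0∞} (hC : C < ⊤)
    (h : ∀ n, ∫⁻ z in A n, ENNReal.ofReal (density γ (fun _ => 1) (Φs n) z) ≤ C) :
    ∃ (k : ℕ → ℕ) (Φ : Pair), StrictMono k ∧ PairH1loc Φ ∧
      WeakTendstoH1loc (fun n => Φs (k n)) Φ := by
  -- The potential bounds $\phi_i^2$ only up to an additive constant, which is not integrable over
  -- the line; a Gaussian weight makes it so.
  let ρ : ℝ → ℝ := fun z => Real.exp (-z ^ 2)
  have hρ : Continuous ρ := by fun_prop
  have hρ0 : ∀ z, 0 < ρ z := fun z => Real.exp_pos _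
  have hρ1 : ∀ z, ρ z ≤ 1 := fun z => Real.exp_le_one_iff.2 (by nlinarith [sq_nonneg z])
  have hρi : Integrable ρ volume := by
    simpa [ρ] using integrable_exp_neg_mul_sq (b := 1) one_pos
  let B : ℝ≥0∞ := 2 * ∫⁻ z, ENNReal.ofReal (ρ z)
  have hB : B < ⊤ := ENNReal.mul_lt_top (by norm_num) hρi.lintegral_lt_top
  have h1 : ∀ i n, ∫⁻ z in A n, ENNReal.ofReal (weakDeriv (Φs n i) z ^ 2) ≤ B + 4 * C := by
    intro i n
    calc ∫⁻ z in A n, ENNReal.ofReal (weakDeriv (Φs n i) z ^ 2)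
        -- The factor 2 would do; 4 gives the same bound as for the functions.
        ≤ ∫⁻ z in A n, 4 * ENNReal.ofReal (density γ (fun _ => 1) (Φs n) z) := by
          refine lintegral_mono fun z => ?_
          rw [← ENNReal.ofReal_ofNat 4, ← ENNReal.ofReal_mul (by norm_num)]
          refine ENNReal.ofReal_le_ofReal ?_
          linarith [weakDeriv_sq_le_density_one (Φ := Φs n) (z := z) hγ i,
            density_one_nonneg (Φ := Φs n) (z := z) hγ]
      _ = 4 * ∫⁻ z in A n, ENNReal.ofReal (density γ (fun _ => 1) (Φs n) z) :=
          lintegral_const_mul' _ _ (by norm_num)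
      _ ≤ 4 * C := by gcongr; exact h n
      _ ≤ B + 4 * C := le_add_self
  have h2 : ∀ i n, ∫⁻ z in A n, ENNReal.ofReal ((ρ z * Φs n i z) ^ 2) ≤ B + 4 * C := by
    intro i n
    calc ∫⁻ z in A n, ENNReal.ofReal ((ρ z * Φs n i z) ^ 2)
        ≤ ∫⁻ z in A n, (2 * ENNReal.ofReal (ρ z) +
            4 * ENNReal.ofReal (density γ (fun _ => 1) (Φs n) z)) := by
          refine lintegral_mono fun z => ?_
          have hd := density_one_nonneg (Φ := Φs n) (z := z) hγ
          have hp := (hρ0 z).le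
          rw [← ENNReal.ofReal_ofNat 4, ← ENNReal.ofReal_ofNat 2,
            ← ENNReal.ofReal_mul (by norm_num), ← ENNReal.ofReal_mul (by norm_num),
            ← ENNReal.ofReal_add (by positivity) (by positivity)]
          refine ENNReal.ofReal_le_ofReal ?_
          have e1 : ρ z ^ 2 ≤ ρ z := by nlinarith [hρ1 z]
          have e2 : ρ z ^ 2 ≤ 1 := e1.trans (hρ1 z)
          have e3 := mul_le_mul_of_nonneg_left
            (sq_le_density_one (Φ := Φs n) (z := z) hγ i) (sq_nonneg (ρ z))
          have e4 := mul_le_mul_of_nonneg_right e2 hd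
          rw [mul_pow]
          linarith
      _ = 2 * (∫⁻ z in A n, ENNReal.ofReal (ρ z)) +
          4 * ∫⁻ z in A n, ENNReal.ofReal (density γ (fun _ => 1) (Φs n) z) := by
          rw [lintegral_add_left (by fun_prop), lintegral_const_mul' _ _ (by norm_num),
            lintegral_const_mul' _ _ (by norm_num)]
      _ ≤ B + 4 * C := by
          gcongr
          · exact mul_le_mul_right (setLIntegral_le_lintegral _ _) 2
          · exact h n
  have hBC : B + 4 * C < ⊤ := ENNReal.add_lt_top.2 ⟨hB, ENNReal.mul_lt_top (by norm_num) hC⟩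
  obtain ⟨k, u, hk, hu, hku, hku'⟩ := exists_subseq_weakTendsto_weakDeriv
    (fun n => hΦ n 0) hρ (fun z => (hρ0 z).ne') hA hAR hBC (h2 0) (h1 0)
  obtain ⟨l, v, hl, hv, hlv, hlv'⟩ := exists_subseq_weakTendsto_weakDeriv
    (fun n => hΦ (k n) 1) hρ (fun z => (hρ0 z).ne') (fun n => hA (k n))
    (fun R => hk.tendsto_atTop.eventually (hAR R)) hBC (fun n => h2 1 (k n))
    (fun n => h1 1 (k n))
  refine ⟨k ∘ l, ![u, v], hk.comp hl, ?_, weakTendstoH1loc_of_forall ?_⟩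
  · intro i
    fin_cases i
    · exact hu
    · exact hv
  · intro i
    fin_cases i
    · exact ⟨hku.comp hl, hku'.comp hl⟩
    · exact ⟨hlv, hlv'⟩

theorem exists_subseq_weakTendstoH1loc {γ : ℝ} (hγ : 1 ≤ γ) {η : ℝ → ℝ → ℝ}
    (hη : ∀ ε ∈ Ioo (0 : ℝ) 1, IsGroundState ε (η ε)) {ε : ℕ → ℝ} {Φs : ℕ → Pair}
    (hε : ∀ n, ε n ∈ Ioo (0 : ℝ) 1) (hε0 : Tendsto ε atTop (𝓝 0))
    (hΦ : ∀ n, PairH1loc (Φs n)) {C : ℝ≥0∞} (hC : C < ⊤)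
    (hJ : ∀ n, J γ (ε n) (η (ε n)) (Φs n) ≤ C) :
    ∃ (k : ℕ → ℕ) (Φ : Pair), StrictMono k ∧ PairH1loc Φ ∧
      WeakTendstoH1loc (fun n => Φs (k n)) Φ := by
  -- The bound by 1/4 needs $\varepsilon_n\le1/8$, so the first $N$ terms are dropped.
  obtain ⟨N, hN⟩ := eventually_atTop.1 (hε0.eventually (gt_mem_nhds (by norm_num : (0 : ℝ) < 1 / 8)))
  have hθ : 0 < ENNReal.ofReal ((1 / 4) ^ 4) := ENNReal.ofReal_pos.2 (by norm_num)
  have hs : StrictMono fun n => n + N := strictMono_id.add_const N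
  obtain ⟨k, Φ, hk, hΦ', hlim⟩ := exists_subseq_weakTendstoH1loc_of_le
    (fun n => hΦ (n + N)) hγ (A := fun n => core (ε (n + N)))
    (fun n => measurableSet_core _)
    (fun R => eventually_Icc_subset_core (hε0.comp hs.tendsto_atTop) R)
    (C := C / ENNReal.ofReal ((1 / 4) ^ 4)) (ENNReal.div_lt_top hC.ne hθ.ne')
    (fun n => by
      rw [ENNReal.le_div_iff_mul_le (.inl hθ.ne') (.inl ENNReal.ofReal_ne_top), mul_comm]
      refine (ofReal_pow_four_mul_setLIntegral_le hγ (by norm_num) (by norm_num)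
        (measurableSet_core _) (fun z hz => ?_) (hΦ (n + N))).trans (hJ (n + N))
      exact (hη _ (hε _)).quarter_le (hε _).1 (hN _ (by omega)).le hz)
  exact ⟨fun n => k n + N, Φ, hs.comp hk, hΦ', hlim⟩

/-! ### The limsup inequality -/

theorem limsup_J_const_le {γ : ℝ} (hγ : 1 ≤ γ) {η : ℝ → ℝ → ℝ}
    (hη : ∀ ε ∈ Ioo (0 : ℝ) 1, IsGroundState ε (η ε)) {Φ : Pair} (hΦ : PairH1loc Φ) :
    limsup (fun ε => J γ ε (η ε) Φ) (𝓝[>] 0) ≤ J₀ γ Φ := by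
  refine limsup_le_of_le (by isBoundedDefault) ?_
  filter_upwards [Ioo_mem_nhdsGT (zero_lt_one (α := ℝ))] with ε hε
  rw [J, J₀, energy, energy, if_pos hΦ, if_pos hΦ]
  exact lintegral_mono fun z => ENNReal.ofReal_le_ofReal
    (density_le_density_one hγ ((hη ε hε).pos _).le ((hη ε hε).le_one _))

theorem tendstoL2loc_const {ι : Type} (l : Filter ι) (Φ : Pair) :
    TendstoL2loc (fun _ => Φ) l Φ := by
  intro K _ i
  simpa using tendsto_const_nhds

/-! ### Lower semicontinuity and the liminf inequality -/

/-- Joint lower semicontinuity of the homogeneous energy on a bounded interval, under pointwise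
convergence of the functions and weak convergence of the derivatives. -/
theorem setLIntegral_density_one_le_of_tendsto {γ : ℝ} (hγ : 1 ≤ γ) {R : ℝ} (hR : 0 < R)
    {Φs : ℕ → Pair} {Φ : Pair} (hΦs : ∀ n, PairH1loc (Φs n)) (hΦ : PairH1loc Φ)
    (hweak : WeakTendstoH1loc Φs Φ)
    (hae : ∀ i, ∀ᵐ z ∂volume.restrict (Icc (-R) R),
      Tendsto (fun n => Φs n i z) atTop (𝓝 (Φ i z)))
    {b : ℕ → ℝ≥0∞} {B : ℝ≥0∞} (hb : Tendsto b atTop (𝓝 B))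
    (h : ∀ᶠ n in atTop,
      ∫⁻ z in Icc (-R) R, ENNReal.ofReal (density γ (fun _ => 1) (Φs n) z) ≤ b n) :
    ∫⁻ z in Icc (-R) R, ENNReal.ofReal (density γ (fun _ => 1) Φ z) ≤ B := by
  have hγ0 : 0 ≤ γ - 1 := sub_nonneg.2 hγ
  let G : Pair → ℝ → ℝ := fun Ψ z =>
    1 / 2 * (weakDeriv (Ψ 0) z * weakDeriv (Ψ 0) z + weakDeriv (Ψ 1) z * weakDeriv (Ψ 1) z)
  let V : Pair → ℝ → ℝ := fun Ψ z =>
    1 / 4 * (Ψ 0 z ^ 2 + Ψ 1 z ^ 2 - 1) ^ 2 + (γ - 1) / 2 * (Ψ 0 z ^ 2 * Ψ 1 z ^ 2)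
  have hG0 : ∀ Ψ z, 0 ≤ G Ψ z := fun Ψ z => by
    have := mul_self_nonneg (weakDeriv (Ψ 0) z)
    have := mul_self_nonneg (weakDeriv (Ψ 1) z)
    positivity
  have hV0 : ∀ Ψ z, 0 ≤ V Ψ z := fun Ψ z => by positivity
  have hm : ∀ {Ψ : Pair}, PairH1loc Ψ → ∀ i,
      MemLp (weakDeriv (Ψ i)) 2 (volume.restrict (Icc (-R) R)) := fun hΨ i =>
    (hΨ i).memL2loc_weakDeriv _ isCompact_Icc
  have hi : ∀ {Ψ Θ : Pair}, PairH1loc Ψ → PairH1loc Θ → ∀ i,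
      Integrable (fun z => weakDeriv (Ψ i) z * weakDeriv (Θ i) z) (volume.restrict (Icc (-R) R)) :=
    fun hΨ hΘ i => (hm hΨ i).integrable_mul (hm hΘ i)
  have hGi : ∀ {Ψ}, PairH1loc Ψ → Integrable (G Ψ) (volume.restrict (Icc (-R) R)) := fun hΨ =>
    ((hi hΨ hΨ 0).add (hi hΨ hΨ 1)).const_mul _
  have hVm : ∀ {Ψ}, PairH1loc Ψ →
      AEMeasurable (fun z => ENNReal.ofReal (V Ψ z)) (volume.restrict (Icc (-R) R)) := by
    intro Ψ hΨ
    have h0 := (hΨ 0).1.aestronglyMeasurable.aemeasurable.restrict (s := Icc (-R) R)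
    have h1 := (hΨ 1).1.aestronglyMeasurable.aemeasurable.restrict (s := Icc (-R) R)
    exact AEMeasurable.ennreal_ofReal (by fun_prop)
  have hsplit : ∀ {Ψ}, PairH1loc Ψ →
      ∫⁻ z in Icc (-R) R, ENNReal.ofReal (density γ (fun _ => 1) Ψ z) =
        ENNReal.ofReal (∫ z in Icc (-R) R, G Ψ z) +
          ∫⁻ z in Icc (-R) R, ENNReal.ofReal (V Ψ z) := by
    intro Ψ hΨ
    rw [ofReal_integral_eq_lintegral_ofReal (hGi hΨ) (.of_forall (hG0 Ψ)),
      ← lintegral_add_right' _ (hVm hΨ)]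
    refine lintegral_congr fun z => ?_
    rw [← ENNReal.ofReal_add (hG0 Ψ z) (hV0 Ψ z)]
    congr 1
    simp only [density, G, V]
    ring
  -- The tangent to the gradient energy at $\Phi$: it lies below that energy by convexity, agrees
  -- with it at $\Phi$, and is continuous under weak convergence.
  let m : Pair → ℝ := fun Ψ => (∫ z in Icc (-R) R, weakDeriv (Ψ 0) z * weakDeriv (Φ 0) z) +
    (∫ z in Icc (-R) R, weakDeriv (Ψ 1) z * weakDeriv (Φ 1) z) - ∫ z in Icc (-R) R, G Φ z
  have hmle : ∀ {Ψ}, PairH1loc Ψ → m Ψ ≤ ∫ z in Icc (-R) R, G Ψ z := by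
    intro Ψ hΨ
    have hs : Integrable (fun z => weakDeriv (Ψ 0) z * weakDeriv (Φ 0) z +
        weakDeriv (Ψ 1) z * weakDeriv (Φ 1) z) (volume.restrict (Icc (-R) R)) :=
      (hi hΨ hΦ 0).add (hi hΨ hΦ 1)
    simp only [m]
    rw [← integral_add (hi hΨ hΦ 0) (hi hΨ hΦ 1), ← integral_sub hs (hGi hΦ)]
    refine integral_mono (hs.sub (hGi hΦ)) (hGi hΨ) fun z => ?_
    simp only [G]
    nlinarith [sq_nonneg (weakDeriv (Ψ 0) z - weakDeriv (Φ 0) z),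
      sq_nonneg (weakDeriv (Ψ 1) z - weakDeriv (Φ 1) z)]
  have hmΦ : m Φ = ∫ z in Icc (-R) R, G Φ z := by
    simp only [m, G]
    rw [integral_const_mul, integral_add (hi hΦ hΦ 0) (hi hΦ hΦ 1)]
    ring
  have hmlim : Tendsto (fun n => m (Φs n)) atTop (𝓝 (m Φ)) :=
    (((hweak R hR 0 _ (hm hΦ 0)).2).add ((hweak R hR 1 _ (hm hΦ 1)).2)).sub_const _
  have hmlim' : Tendsto (fun n => ENNReal.ofReal (m (Φs n))) atTop (𝓝 (ENNReal.ofReal (m Φ))) :=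
    (ENNReal.continuous_ofReal.tendsto _).comp hmlim
  have hle : ∀ᶠ n in atTop, ENNReal.ofReal (m (Φs n)) +
      ∫⁻ z in Icc (-R) R, ENNReal.ofReal (V (Φs n) z) ≤ b n := by
    filter_upwards [h] with n hn
    refine le_trans ?_ hn
    rw [hsplit (hΦs n)]
    gcongr
    exact hmle (hΦs n)
  have hmB : ENNReal.ofReal (m Φ) ≤ B := le_of_tendsto_of_tendsto hmlim' hb (by
    filter_upwards [hle] with n hn using le_self_add.trans hn)
  have hVlim : ∀ᵐ z ∂volume.restrict (Icc (-R) R), ENNReal.ofReal (V Φ z) =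
      liminf (fun n => ENNReal.ofReal (V (Φs n) z)) atTop := by
    filter_upwards [hae 0, hae 1] with z h0 h1
    refine ((ENNReal.continuous_ofReal.tendsto _).comp (Tendsto.add ?_ ?_)).liminf_eq.symm
    · exact ((((h0.pow 2).add (h1.pow 2)).sub_const 1).pow 2).const_mul _
    · exact ((h0.pow 2).mul (h1.pow 2)).const_mul _
  -- Fatou for the potential alone, after subtracting the convergent gradient bound, whose finite
  -- limit keeps the subtraction continuous.
  have hV : ∫⁻ z in Icc (-R) R, ENNReal.ofReal (V Φ z) ≤ B - ENNReal.ofReal (m Φ) := by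
    rw [lintegral_congr_ae hVlim]
    refine (lintegral_liminf_le' fun n => hVm (hΦs n)).trans ?_
    have hlim := ENNReal.Tendsto.sub hb hmlim' (.inr ENNReal.ofReal_ne_top)
    rw [← hlim.liminf_eq]
    refine liminf_le_liminf ?_
    filter_upwards [hle] with n hn
    exact ENNReal.le_sub_of_add_le_left ENNReal.ofReal_ne_top hn
  rw [hsplit hΦ, ← hmΦ]
  calc _ ≤ ENNReal.ofReal (m Φ) + (B - ENNReal.ofReal (m Φ)) := by gcongr
    _ = B := add_tsub_cancel_of_le hmB

theorem tendsto_integral_mul_of_tendsto_eLpNorm {α : Type*} [MeasurableSpace α] {μ : Measure α}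
    {f : ℕ → α → ℝ} {u g : α → ℝ} (hf : ∀ n, MemLp (f n) 2 μ) (hu : MemLp u 2 μ)
    (hg : MemLp g 2 μ) (h : Tendsto (fun n => eLpNorm (f n - u) 2 μ) atTop (𝓝 0)) :
    Tendsto (fun n => ∫ x, f n x * g x ∂μ) atTop (𝓝 (∫ x, u x * g x ∂μ)) := by
  simp only [integral_mul_eq_inner (hf _) hg, integral_mul_eq_inner hu hg]
  exact ((Lp.tendsto_Lp_iff_tendsto_eLpNorm'' f hf u hu).2 h).inner tendsto_const_nhds

theorem iUnion_Icc_neg_nat_add_one : (⋃ n : ℕ, Icc (-((n : ℝ) + 1)) (n + 1)) = univ := by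
  refine eq_univ_of_forall fun x => mem_iUnion.2 ?_
  obtain ⟨n, hn⟩ := exists_nat_ge |x|
  exact ⟨n, abs_le.1 (by linarith)⟩

theorem ae_eq_of_forall_ae_restrict_Icc {u v : ℝ → ℝ}
    (h : ∀ R : ℝ, 0 < R → u =ᵐ[volume.restrict (Icc (-R) R)] v) : u =ᵐ[volume] v := by
  have h1 := (ae_restrict_iUnion_iff (μ := volume) (fun n : ℕ => Icc (-((n : ℝ) + 1)) (n + 1))
    fun x => u x = v x).2 fun n => h (n + 1) (by positivity)
  rwa [iUnion_Icc_neg_nat_add_one, Measure.restrict_univ] at h1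

/-- Weak and strong limits coincide. -/
theorem ae_eq_of_weakTendsto_of_tendstoL2loc {Φs : ℕ → Pair} {Φ Ψ : Pair}
    (hΦs : ∀ n, PairH1loc (Φs n)) (hΦ : PairL2loc Φ) (hΨ : PairH1loc Ψ)
    (hweak : WeakTendstoH1loc Φs Ψ) (hstrong : TendstoL2loc Φs atTop Φ) (i : Fin 2) :
    Ψ i =ᵐ[volume] Φ i := by
  refine ae_eq_of_forall_ae_restrict_Icc fun R hR => ?_
  have hu := hΦ i _ (isCompact_Icc (a := -R) (b := R))
  have hv := (hΨ i).1 _ (isCompact_Icc (a := -R) (b := R))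
  -- Testing both convergences with the difference of the limits makes its $L^2$ norm vanish.
  have hg : MemLp (fun z => Ψ i z - Φ i z) 2 (volume.restrict (Icc (-R) R)) := hv.sub hu
  have heq := tendsto_nhds_unique (hweak R hR i _ hg).1
    (tendsto_integral_mul_of_tendsto_eLpNorm (fun n => (hΦs n i).1 _ isCompact_Icc) hu hg
      (hstrong _ isCompact_Icc i))
  have h0 : ∫ z in Icc (-R) R, (Ψ i z - Φ i z) * (Ψ i z - Φ i z) = 0 := by
    have h1 : Integrable (fun z => Ψ i z * (Ψ i z - Φ i z)) (volume.restrict (Icc (-R) R)) :=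
      hv.integrable_mul hg
    have h2 : Integrable (fun z => Φ i z * (Ψ i z - Φ i z)) (volume.restrict (Icc (-R) R)) :=
      hu.integrable_mul hg
    rw [← sub_eq_zero.2 heq, ← integral_sub h1 h2]
    exact integral_congr_ae (.of_forall fun z => by ring)
  rw [integral_eq_zero_iff_of_nonneg (fun z => mul_self_nonneg _) (hg.integrable_mul hg)] at h0
  filter_upwards [h0] with z hz
  exact sub_eq_zero.1 (mul_self_eq_zero.1 hz)

theorem exists_subseq_ae_tendsto {Φs : ℕ → Pair} {Φ : Pair} (hΦs : ∀ n, PairL2loc (Φs n))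
    (hΦ : PairL2loc Φ) (h : TendstoL2loc Φs atTop Φ) {K : Set ℝ} (hK : IsCompact K) :
    ∃ k : ℕ → ℕ, StrictMono k ∧ ∀ i, ∀ᵐ z ∂volume.restrict K,
      Tendsto (fun n => Φs (k n) i z) atTop (𝓝 (Φ i z)) := by
  have hm : ∀ i {k : ℕ → ℕ}, StrictMono k →
      TendstoInMeasure (volume.restrict K) (fun n => Φs (k n) i) atTop (Φ i) := fun i k hk =>
    tendstoInMeasure_of_tendsto_eLpNorm (by norm_num)
      (fun n => (hΦs (k n) i K hK).aestronglyMeasurable) (hΦ i K hK).aestronglyMeasurable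
      ((h K hK i).comp hk.tendsto_atTop)
  obtain ⟨k, hk, hk0⟩ := (hm 0 strictMono_id).exists_seq_tendsto_ae
  obtain ⟨l, hl, hl1⟩ := (hm 1 hk).exists_seq_tendsto_ae
  refine ⟨k ∘ l, hk.comp hl, fun i => ?_⟩
  fin_cases i
  · filter_upwards [hk0] with z hz using hz.comp hl.tendsto_atTop
  · exact hl1

theorem WeakTendstoH1loc.comp {Φs : ℕ → Pair} {Φ : Pair} (h : WeakTendstoH1loc Φs Φ)
    {k : ℕ → ℕ} (hk : StrictMono k) : WeakTendstoH1loc (fun n => Φs (k n)) Φ :=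
  fun R hR i g hg => ⟨((h R hR i g hg).1).comp hk.tendsto_atTop,
    ((h R hR i g hg).2).comp hk.tendsto_atTop⟩

theorem WeakTendstoH1loc.congr_ae {Φs : ℕ → Pair} {Φ Ψ : Pair} (h : WeakTendstoH1loc Φs Ψ)
    (hΨ : PairH1loc Ψ) (he : ∀ i, Ψ i =ᵐ[volume] Φ i) : WeakTendstoH1loc Φs Φ :=
  weakTendstoH1loc_of_forall fun i =>
    ⟨WeakTendstoL2loc.congr_ae_right (fun R hR g hg => (h R hR i g hg).1) (he i),
      WeakTendstoL2loc.congr_ae_right (fun R hR g hg => (h R hR i g hg).2)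
        ((hΨ i).weakDeriv_congr_ae (he i))⟩

theorem TendstoL2loc.comp {Φs : ℕ → Pair} {Φ : Pair} (h : TendstoL2loc Φs atTop Φ)
    {k : ℕ → ℕ} (hk : StrictMono k) : TendstoL2loc (fun n => Φs (k n)) atTop Φ :=
  fun K hK i => (h K hK i).comp hk.tendsto_atTop

theorem lintegral_le_of_forall_setLIntegral_Icc_le {f : ℝ → ℝ≥0∞} {C : ℝ≥0∞}
    (h : ∀ R : ℝ, 0 < R → ∫⁻ z in Icc (-R) R, f z ≤ C) : ∫⁻ z, f z ≤ C := by
  have hmono : Monotone fun n : ℕ => Icc (-((n : ℝ) + 1)) (n + 1) := fun m n hmn => by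
    have : (m : ℝ) ≤ n := by exact_mod_cast hmn
    exact Icc_subset_Icc (by linarith) (by linarith)
  rw [← setLIntegral_univ, ← iUnion_Icc_neg_nat_add_one, setLIntegral_iUnion_of_directed _ hmono.directed_le]
  exact iSup_le fun n => h _ (by positivity)

/-- The liminf inequality for a sequence of bounded energy. The subsequence converging almost
everywhere depends on $R$, but the bound $C$ does not, so $R$ can tend to infinity. -/
theorem J₀_le_of_forall_J_le {γ : ℝ} (hγ : 1 ≤ γ) {η : ℝ → ℝ → ℝ}
    (hη : ∀ ε ∈ Ioo (0 : ℝ) 1, IsGroundState ε (η ε)) {ε : ℕ → ℝ} {Φs : ℕ → Pair} {Φ : Pair}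
    (hε : ∀ n, ε n ∈ Ioo (0 : ℝ) 1) (hε0 : Tendsto ε atTop (𝓝 0))
    (hΦs : ∀ n, PairH1loc (Φs n)) (hΦ : PairL2loc Φ) (hlim : TendstoL2loc Φs atTop Φ)
    {C : ℝ≥0∞} (hC : C < ⊤) (hJ : ∀ n, J γ (ε n) (η (ε n)) (Φs n) ≤ C) : J₀ γ Φ ≤ C := by
  obtain ⟨k, Ψ, hk, hΨ, hweak⟩ := exists_subseq_weakTendstoH1loc hγ hη hε hε0 hΦs hC hJ
  have he : ∀ i, Ψ i =ᵐ[volume] Φ i := ae_eq_of_weakTendsto_of_tendstoL2loc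
    (fun n => hΦs (k n)) hΦ hΨ hweak (hlim.comp hk)
  have hΦ1 : PairH1loc Φ := fun i => (hΨ i).congr_ae (he i)
  have hweakΦ := hweak.congr_ae hΨ he
  rw [J₀, energy, if_pos hΦ1]
  refine lintegral_le_of_forall_setLIntegral_Icc_le fun R hR => ?_
  obtain ⟨l, hl, hae⟩ := exists_subseq_ae_tendsto (fun n i => (hΦs (k n) i).1) hΦ (hlim.comp hk)
    (isCompact_Icc (a := -R) (b := R))
  have hkl : StrictMono fun n => k (l n) := hk.comp hl
  have hδ : Tendsto (fun n => ε (k (l n))) atTop (𝓝 0) := hε0.comp hkl.tendsto_atTop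
  -- The value of the cosine barrier at $z=R$, its minimum over $[-R,R]$ once
  -- $\sqrt{\varepsilon}R\le1$.
  let θ : ℕ → ℝ := fun n => √(1 - 4 * ε (k (l n))) * Real.cos (√(ε (k (l n))) * R)
  have hθ : Tendsto θ atTop (𝓝 1) := by
    have hc : Continuous fun e : ℝ => √(1 - 4 * e) * Real.cos (√e * R) := by fun_prop
    rw [show (1 : ℝ) = √(1 - 4 * 0) * Real.cos (√0 * R) by simp]
    exact (hc.tendsto 0).comp hδ
  have hθ4 : Tendsto (fun n => ENNReal.ofReal (θ n ^ 4)) atTop (𝓝 1) := by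
    rw [show (1 : ℝ≥0∞) = ENNReal.ofReal (1 ^ 4) by simp]
    exact (ENNReal.continuous_ofReal.tendsto _).comp (hθ.pow 4)
  have hb : Tendsto (fun n => C / ENNReal.ofReal (θ n ^ 4)) atTop (𝓝 C) := by
    simpa using ENNReal.Tendsto.div (tendsto_const_nhds (x := C)) (.inr one_ne_zero) hθ4
      (.inl ENNReal.one_ne_top)
  refine setLIntegral_density_one_le_of_tendsto hγ hR (fun n => hΦs (k (l n))) hΦ1
    (hweakΦ.comp hl) hae hb ?_
  have hsR : Tendsto (fun n => √(ε (k (l n))) * R) atTop (𝓝 0) := by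
    simpa using ((Real.continuous_sqrt.tendsto 0).comp hδ).mul_const R
  filter_upwards [hθ.eventually (lt_mem_nhds one_pos), hδ.eventually (gt_mem_nhds
    (by norm_num : (0 : ℝ) < 1 / 4)), hsR.eventually (gt_mem_nhds one_pos)] with n hθn hεn hRn
  have hεp := (hε (k (l n))).1
  have hθ0 : 0 < ENNReal.ofReal (θ n ^ 4) := ENNReal.ofReal_pos.2 (by positivity)
  rw [ENNReal.le_div_iff_mul_le (.inl hθ0.ne') (.inl ENNReal.ofReal_ne_top), mul_comm]
  refine (ofReal_pow_four_mul_setLIntegral_le hγ hθn.le ?_ measurableSet_Icc (fun z hz => ?_)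
    (hΦs (k (l n)))).trans (hJ (k (l n)))
  · exact mul_le_one₀ (Real.sqrt_le_one.2 (by linarith))
      (pos_of_mul_pos_right hθn (Real.sqrt_nonneg _)).le (Real.cos_le_one _)
  · have hz1 : |√(ε (k (l n))) * z| ≤ √(ε (k (l n))) * R := by
      rw [abs_mul, abs_of_nonneg (Real.sqrt_nonneg _)]
      exact mul_le_mul_of_nonneg_left (abs_le.2 hz) (Real.sqrt_nonneg _)
    refine le_trans ?_ ((hη _ (hε _)).sqrt_mul_cos_le hεp hεn
      (by linarith [Real.pi_gt_three] : |√(ε (k (l n))) * z| ≤ Real.pi / 2))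
    refine mul_le_mul_of_nonneg_left ?_ (Real.sqrt_nonneg _)
    rw [← Real.cos_abs (√(ε (k (l n))) * z)]
    exact Real.cos_le_cos_of_nonneg_of_le_pi (abs_nonneg _)
      (by linarith [Real.pi_gt_three]) hz1

end DomainWalls

open DomainWalls in
theorem theorem1p1 (γ : ℝ) (hγ : 1 < γ) (η : ℝ → ℝ → ℝ)
    (hη : ∀ ε ∈ Ioo (0 : ℝ) 1, IsGroundState ε (η ε)) :
    -- compactness
    (∀ (ε : ℕ → ℝ) (Φs : ℕ → Pair), (∀ n, ε n ∈ Ioo (0 : ℝ) 1) → Tendsto ε atTop (𝓝 0) →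
      (∀ n, PairH1loc (Φs n)) →
      (∃ C : ℝ≥0∞, C < ⊤ ∧ ∀ n, J γ (ε n) (η (ε n)) (Φs n) ≤ C) →
      ∃ (k : ℕ → ℕ) (Φ : Pair), StrictMono k ∧ PairH1loc Φ ∧
        WeakTendstoH1loc (fun n => Φs (k n)) Φ) ∧
    -- liminf inequality
    (∀ (ε : ℕ → ℝ) (Φs : ℕ → Pair) (Φ : Pair), (∀ n, ε n ∈ Ioo (0 : ℝ) 1) →
      Tendsto ε atTop (𝓝 0) → (∀ n, PairH1loc (Φs n)) → PairL2loc Φ →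
      TendstoL2loc Φs atTop Φ →
      J₀ γ Φ ≤ liminf (fun n => J γ (ε n) (η (ε n)) (Φs n)) atTop) ∧
    -- limsup inequality, with the constant recovery family
    (∀ Φ : Pair, PairH1loc Φ →
      ∃ Φs : ℝ → Pair, (∀ ε, Φs ε = Φ) ∧ (∀ ε, PairH1loc (Φs ε)) ∧
        TendstoL2loc Φs (𝓝[>] 0) Φ ∧
        limsup (fun ε => J γ ε (η ε) (Φs ε)) (𝓝[>] 0) ≤ J₀ γ Φ) := by
  refine ⟨?_, ?_, ?_⟩
  · rintro ε Φs hε hε0 hΦs ⟨C, hC, hJ⟩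
    exact exists_subseq_weakTendstoH1loc hγ.le hη hε hε0 hΦs hC hJ
  · intro ε Φs Φ hε hε0 hΦs hΦ hlim
    -- Any $C$ above the liminf bounds the energies along a subsequence, which is what compactness
    -- needs when $C$ is finite.
    refine le_of_forall_gt_imp_ge_of_dense fun C hC => ?_
    rcases eq_or_ne C ⊤ with rfl | hCt
    · exact le_top
    obtain ⟨j, hj, hjC⟩ := extraction_of_frequently_atTop
      (frequently_lt_of_liminf_lt (by isBoundedDefault) hC)
    exact J₀_le_of_forall_J_le hγ.le hη (fun n => hε (j n)) (hε0.comp hj.tendsto_atTop)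
      (fun n => hΦs (j n)) hΦ (hlim.comp hj) hCt.lt_top fun n => (hjC n).le
  · intro Φ hΦ
    exact ⟨fun _ => Φ, fun _ => rfl, fun _ => hΦ, tendstoL2loc_const _ Φ,
      limsup_J_const_le hγ.le hη hΦ⟩
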